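/- Conventions: manifolds are topological manifolds, closed means compact without boundary, actions of groups on manifolds are continuous. A finite covering is a surjective covering map with finite fibres. For a closed manifold $Y$ let $\mu(Y)$ be the set of integers $m\ge 1$ such that for arbitrarily large $r$ there is an effective action of $(\mathbb Z/r)^m$ on $Y$, and let $\operatorname{disc-sym}(Y)=\max(\{0\}\cup\mu(Y))$ (understood as the supremum in $\mathbb N\cup\{\infty\}$; it is finite, hence a maximum, by a theorem of Mann and Su). **Theorem.** Let $X$ be a closed connected manifold and let $\rho:X'\to X$ be a finite covering, with $X'$ not necessarily connected. Then $$\operatorname{disc-sym}(X')\ \ge\ \operatorname{disc-sym}(X).$$ More precisely, for every integer $b\ge 0$ there is a constant $C$, depending only on $\rho$ and $b$, such that for every integer $a\ge 1$ and every effective action of $(\mathbb Z/a)^b$ on $X$ there are an integer $a'\ge 1$ with $Ca'\ge a$, an effective action of $(\mathbb Z/a')^b$ on $X'$, and a group homomorphism $\varphi:(\mathbb Z/a')^b\to(\mathbb Z/a)^b$ whose image has index at most $C$ in $(\mathbb Z/a)^b$, such that $\rho(g\cdot x')=\varphi(g)\cdot\rho(x')$ for all $g\in(\mathbb Z/a')^b$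 and $x'\in X'$. -/

import Mathlib

/-- The group `(ℤ/r)^m`, written multiplicatively. -/
abbrev CyclicPower (r m : ℕ) : Type := Multiplicative (Fin m → ZMod r)

/-- `G` (with the discrete topology) acts continuously and effectively on `X`: a continuous action
is a homomorphism from `G` to the homeomorphism group of `X`, and it is effective if this
homomorphism is injective. -/
def SupportsEffectiveAction (G X : Type*) [Group G] [TopologicalSpace X] : Prop :=
  ∃ θ : G →* (X ≃ₜ X), Function.Injective θ

/-- The set `μ(X)` of all positive integers `m` such that `X` supports effective actions of
`(ℤ/r)^m` for arbitrarily large `r`. -/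
def muSet (X : Type*) [TopologicalSpace X] : Set ℕ :=
  {m | 1 ≤ m ∧ ∀ N : ℕ, ∃ r : ℕ, N < r ∧ SupportsEffectiveAction (CyclicPower r m) X}

/-- The discrete degree of symmetry, `max ({0} ∪ μ(X))`. It is formed as a supremum in `ℕ∞`, so
that no junk value occurs: it is the natural number `d` exactly when `d` is the
maximum of `{0} ∪ μ(X)` (see `discSym_eq_coe_iff`), and it is `⊤` exactly when `μ(X)` is
unbounded. -/
noncomputable def discSym (X : Type*) [TopologicalSpace X] : ℕ∞ :=
  ⨆ m ∈ ({0} ∪ muSet X : Set ℕ), (m : ℕ∞)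

theorem discSym_eq_coe_iff (X : Type*) [TopologicalSpace X] (d : ℕ) :
    discSym X = (d : ℕ∞) ↔ IsGreatest ({0} ∪ muSet X : Set ℕ) d := by
  constructor
  · intro h
    have hub : ∀ m ∈ ({0} ∪ muSet X : Set ℕ), m ≤ d := by
      intro m hm
      have h1 : (m : ℕ∞) ≤ discSym X := le_iSup₂ (f := fun (m : ℕ) _ => (m : ℕ∞)) m hm
      rw [h] at h1
      exact_mod_cast h1
    refine ⟨?_, hub⟩
    by_contra hd
    have hlt : ∀ m ∈ ({0} ∪ muSet X : Set ℕ), m ≤ d - 1 := by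
      intro m hm
      have h1 := hub m hm
      have h2 : m ≠ d := fun e => hd (e ▸ hm)
      omega
    have h0 : d ≠ 0 := fun e => hd (by simp [e])
    have h3 : discSym X ≤ ((d - 1 : ℕ) : ℕ∞) :=
      iSup₂_le fun m hm => by exact_mod_cast hlt m hm
    rw [h] at h3
    have h4 : d ≤ d - 1 := by exact_mod_cast h3
    omega
  · rintro ⟨hd, hub⟩
    exact le_antisymm (iSup₂_le fun m hm => by exact_mod_cast hub hm)
      (le_iSup₂ (f := fun (m : ℕ) _ => (m : ℕ∞)) d hd)

/-- A finite covering: a surjective covering map all of whose fibres are finite. The total space is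
not required to be connected. -/
structure IsFiniteCovering {X' X : Type*} [TopologicalSpace X'] [TopologicalSpace X]
    (ρ : X' → X) : Prop where
  isCoveringMap : IsCoveringMap ρ
  surjective : Function.Surjective ρ
  finite_fiber : ∀ x : X, (ρ ⁻¹' {x}).Finite

/-!
Let `Γ` be the group of
pairs `(h, f)` of homeomorphisms of `X'` and `X` with `ρ ∘ h = f ∘ ρ`, and `π : Γ → Homeo X` the
projection. Everything follows from two finiteness properties of `π`, which depend on `ρ` only.

* The kernel of `π`, the group of deck transformations, is finite
  (`IsFiniteCovering.finite_ker_liftedHomeoBase`), because path lifting shows that a deck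
  transformation is determined by its action on one finite fibre.
* The image of `π` has finite index (`IsFiniteCovering.finiteIndex_range_liftedHomeoBase`). This is
  the fact that a compact manifold has only finitely many coverings of a given degree, in a form
  that needs no finite generation of the fundamental group. All the pullbacks `f^* ρ` are trivial
  over a fixed finite cover of `X` by simply connected open sets. The transition functions are
  locally constant, so after shrinking the cover they are determined by their values at finitely
  many points, and hence take finitely many values. When `f` and `f'` have the same transition
  data, gluing the trivializations gives a lift of `f' ∘ f⁻¹` (`exists_homeomorph_frame`).

The rest is group theory (`exists_cyclicPower_lift`). Given `(ℤ/a)^b` in `Homeo X`, fixed powers of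
the generators lift to commuting elements of `Γ`, hence to a homomorphism `Ψ : ℤ^b → Γ` whose
kernel lies between `K a' ℤ^b` and `a' ℤ^b`, where `K` is the order of `ker π` and `a / a'` is
bounded. So `ker Ψ = a' L` for a lattice `L` of rank `b`, and `Ψ` embeds `L / a' L ≅ (ℤ/a')^b` in
`Γ`. As `ρ` is surjective, `Γ` acts effectively on `X'`.
-/

/-! ### Lifting actions of finite abelian groups through a homomorphism with finite kernel -/

/-- If `π : Γ → G` has finite kernel and its image has finite index, there is one exponent `M` such
that the `M`-th powers of any commuting family in `G` have commuting lifts to `Γ`. -/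
theorem exists_pow_commuting_lift {Γ G ι : Type*} [Group Γ] [Group G] (π : Γ →* G)
    [Finite π.ker] [π.range.FiniteIndex] :
    ∃ M : ℕ, 0 < M ∧ ∀ g : ι → G, (∀ i j, Commute (g i) (g j)) →
      ∃ x : ι → Γ, (∀ i j, Commute (x i) (x j)) ∧ ∀ i, π (x i) = g i ^ M := by
  have : Finite (MulAut π.ker) := Finite.of_injective (fun e : MulAut π.ker => e.toEquiv)
    fun e e' h => MulEquiv.toEquiv_injective h
  refine ⟨π.range.index.factorial * Nat.card (MulAut π.ker) * Nat.card π.ker,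
    Nat.mul_pos (Nat.mul_pos (Nat.factorial_pos _) Nat.card_pos) Nat.card_pos, fun g hg => ?_⟩
  have hlift : ∀ i, ∃ y, π y = g i ^ π.range.index.factorial := fun i =>
    Subgroup.pow_mem_of_index_ne_zero_of_dvd (H := π.range) Subgroup.FiniteIndex.index_ne_zero
      (g i) fun m hm hle => Nat.dvd_factorial hm hle
  choose y hy using hlift
  set z : ι → Γ := fun i => y i ^ Nat.card (MulAut π.ker) with hz
  have hπz : ∀ i, π (z i) = g i ^ (π.range.index.factorial * Nat.card (MulAut π.ker)) := fun i => by
    simp only [hz, map_pow, hy, pow_mul]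
  -- Conjugation by `z i` is a `card (Aut (ker π))`-th power in `Aut (ker π)`, hence trivial.
  have hcent : ∀ i, ∀ k ∈ π.ker, Commute (z i) k := by
    intro i k hk
    have h1 : MulAut.conjNormal (H := π.ker) (z i) = 1 := by
      simp only [hz, map_pow, pow_card_eq_one']
    have h2 := congrArg (fun e : MulAut π.ker => ((e ⟨k, hk⟩ : π.ker) : Γ)) h1
    simp only [MulAut.conjNormal_apply, MulAut.one_apply] at h2
    exact mul_inv_eq_iff_eq_mul.mp h2
  refine ⟨fun i => z i ^ Nat.card π.ker, fun i j => ?_, fun i => by simp only [map_pow, hπz, pow_mul]⟩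
  -- The conjugate of `z i` by `z j` is `k * z i` with `k ∈ ker π` commuting with `z i`.
  refine Commute.pow_right ?_ _
  have hk : z j * z i * (z j)⁻¹ * (z i)⁻¹ ∈ π.ker := by
    have hc : Commute (π (z j)) (π (z i)) := by
      rw [hπz, hπz]; exact (hg j i).pow_pow _ _
    rw [MonoidHom.mem_ker]
    simp only [map_mul, map_inv]
    rw [hc.eq]; group
  have hconj : z j * z i * (z j)⁻¹ = (z j * z i * (z j)⁻¹ * (z i)⁻¹) * z i := by group
  have hpow : z j * z i ^ Nat.card π.ker * (z j)⁻¹ = z i ^ Nat.card π.ker := by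
    rw [← conj_pow, hconj, ((hcent i _ hk).symm).mul_pow]
    have := pow_card_eq_one' (x := (⟨_, hk⟩ : π.ker))
    have h3 := congrArg (Subtype.val) this
    simp only [Subgroup.coe_pow, Subgroup.coe_one] at h3
    rw [h3, one_mul]
  exact (mul_inv_eq_iff_eq_mul.mp hpow).symm

/-- A commuting family indexed by `Fin b` is the image of the standard basis under a homomorphism
from `ℤ^b`. -/
theorem exists_hom_of_commute {Γ : Type*} [Group Γ] {b : ℕ} (x : Fin b → Γ)
    (hx : ∀ i j, Commute (x i) (x j)) :
    ∃ Ψ : Multiplicative (Fin b → ℤ) →* Γ,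
      ∀ i (c : ℤ), Ψ (Multiplicative.ofAdd (Pi.single i c)) = x i ^ c := by
  let Φ : (Fin b → Multiplicative ℤ) →* Γ := MonoidHom.noncommPiCoprod
    (fun i => zpowersHom Γ (x i)) fun i j _ u v => by
      simp only [zpowersHom_apply]
      exact (hx i j).zpow_zpow _ _
  refine ⟨⟨⟨fun v => Φ fun i => Multiplicative.ofAdd (v.toAdd i), ?_⟩, ?_⟩, fun i c => ?_⟩
  · exact map_one Φ
  · intro v w
    exact map_mul Φ (fun i => Multiplicative.ofAdd (v.toAdd i))
      (fun i => Multiplicative.ofAdd (w.toAdd i))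
  · have h : (fun j => Multiplicative.ofAdd ((Pi.single i c : Fin b → ℤ) j)) =
        Pi.mulSingle i (Multiplicative.ofAdd c) := by
      ext j
      by_cases hj : j = i
      · subst hj; simp
      · simp [hj]
    change Φ (fun j => Multiplicative.ofAdd ((Pi.single i c : Fin b → ℤ) j)) = _
    rw [h]
    exact (MonoidHom.noncommPiCoprod_mulSingle _ i _).trans (by simp)

/-- Homomorphisms from `ℤ^b` are determined by their values on multiples of basis vectors. -/
theorem hom_ext_single {Γ : Type*} [Group Γ] {b : ℕ} {Ψ Ψ' : Multiplicative (Fin b → ℤ) →* Γ}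
    (h : ∀ i (c : ℤ), Ψ (Multiplicative.ofAdd (Pi.single i c)) =
      Ψ' (Multiplicative.ofAdd (Pi.single i c))) : Ψ = Ψ' := by
  refine MonoidHom.ext fun v => ?_
  induction v using Multiplicative.rec with | _ v
  rw [← Finset.univ_sum_single v]
  induction (Finset.univ : Finset (Fin b)) using Finset.induction_on with
  | empty => simp
  | insert i s hi ih => rw [Finset.sum_insert hi, ofAdd_add, map_mul, map_mul, ih, h]

/-- A subgroup of `ℤ^b` containing `K • ℤ^b`, `K ≠ 0`, is the image of an injective endomorphism. -/
theorem exists_injective_range_eq {b K : ℕ} (hK : 0 < K) (L : Submodule ℤ (Fin b → ℤ))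
    (hL : ∀ v : Fin b → ℤ, (K : ℤ) • v ∈ L) :
    ∃ Λ : (Fin b → ℤ) →ₗ[ℤ] (Fin b → ℤ), Function.Injective Λ ∧ LinearMap.range Λ = L := by
  have hK' : (K : ℤ) ≠ 0 := by exact_mod_cast hK.ne'
  let s : (Fin b → ℤ) →ₗ[ℤ] L := LinearMap.codRestrict L ((K : ℤ) • LinearMap.id) hL
  have hs : Function.Injective s := fun v w h =>
    smul_right_injective _ hK' (congrArg Subtype.val h)
  have hrank : Module.finrank ℤ L = b := by
    apply le_antisymm
    · simpa using Submodule.finrank_le L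
    · simpa using LinearMap.finrank_le_finrank_of_injective hs
  let B := Module.finBasisOfFinrankEq ℤ L hrank
  refine ⟨L.subtype ∘ₗ B.equivFun.symm.toLinearMap,
    L.injective_subtype.comp B.equivFun.symm.injective, ?_⟩
  rw [LinearMap.range_comp, LinearEquiv.range, Submodule.map_top, Submodule.range_subtype]

/-- Reduction modulo `a` as a homomorphism `ℤ^b → (ℤ/a)^b`. -/
def reduceHom (a b : ℕ) : Multiplicative (Fin b → ℤ) →* CyclicPower a b :=
  AddMonoidHom.toMultiplicative
    (AddMonoidHom.compLeft (Int.castAddHom (ZMod a)) (Fin b))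

theorem reduceHom_apply (a b : ℕ) (v : Fin b → ℤ) :
    reduceHom a b (Multiplicative.ofAdd v) = Multiplicative.ofAdd fun i => (v i : ZMod a) := rfl

theorem reduceHom_surjective (a b : ℕ) : Function.Surjective (reduceHom a b) := by
  intro g
  choose v hv using fun i => ZMod.intCast_surjective (g.toAdd i)
  exact ⟨Multiplicative.ofAdd v, congrArg Multiplicative.ofAdd (funext hv)⟩

theorem reduceHom_eq_one_iff (a b : ℕ) (v : Multiplicative (Fin b → ℤ)) :
    reduceHom a b v = 1 ↔ ∃ w, v = w ^ a := by
  induction v using Multiplicative.rec with | _ v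
  rw [reduceHom_apply]
  constructor
  · intro h
    have h1 : ∀ i, (a : ℤ) ∣ v i := fun i =>
      (ZMod.intCast_zmod_eq_zero_iff_dvd _ _).mp (congrFun (congrArg Multiplicative.toAdd h) i)
    choose w hw using h1
    refine ⟨Multiplicative.ofAdd w, ?_⟩
    rw [← ofAdd_nsmul]
    congr 1
    ext i
    simp [hw i]
  · rintro ⟨w, hw⟩
    have hv : v = a • w.toAdd := congrArg Multiplicative.toAdd hw
    subst hv
    apply Multiplicative.toAdd.injective
    ext i
    simp

/-- A homomorphism on `ℤ^b` killing `a • ℤ^b` factors through `(ℤ/a)^b`. -/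
theorem exists_factor_reduceHom {Γ : Type*} [Group Γ] {a b : ℕ}
    (Ψ : Multiplicative (Fin b → ℤ) →* Γ) (h : ∀ v, Ψ (v ^ a) = 1) :
    ∃ Ψ' : CyclicPower a b →* Γ, ∀ v, Ψ' (reduceHom a b v) = Ψ v := by
  refine ⟨(reduceHom a b).liftOfSurjective (reduceHom_surjective a b) ⟨Ψ, fun v hv => ?_⟩,
    fun v => MonoidHom.liftOfRightInverse_comp_apply _ _ _ _ v⟩
  obtain ⟨w, rfl⟩ := (reduceHom_eq_one_iff a b v).mp hv
  exact h w

/-- A subgroup of `(ℤ/a)^b` containing all `N`-th powers has index at most `N^b`. -/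
theorem index_le_of_pow_mem {a b N : ℕ} (hN : 0 < N) (R : Subgroup (CyclicPower a b))
    (h : ∀ g, g ^ N ∈ R) : R.index ≤ N ^ b := by
  let c : (Fin b → Fin N) → CyclicPower a b ⧸ R := fun r =>
    QuotientGroup.mk (reduceHom a b (Multiplicative.ofAdd fun i => ((r i : ℕ) : ℤ)))
  have hc : Function.Surjective c := by
    intro q
    obtain ⟨g, rfl⟩ := QuotientGroup.mk_surjective q
    obtain ⟨v, rfl⟩ := reduceHom_surjective a b g
    have hN' : (N : ℤ) ≠ 0 := by exact_mod_cast hN.ne'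
    have hlt : ∀ i, (v.toAdd i % N).toNat < N := fun i => by
      have h1 := Int.emod_nonneg (v.toAdd i) hN'
      have h2 := Int.emod_lt_of_pos (v.toAdd i) (by exact_mod_cast hN : (0 : ℤ) < N)
      omega
    refine ⟨fun i => ⟨(v.toAdd i % N).toNat, hlt i⟩, ?_⟩
    have hv : v = Multiplicative.ofAdd (fun i => (((v.toAdd i % N).toNat : ℕ) : ℤ)) *
        (Multiplicative.ofAdd fun i => v.toAdd i / N) ^ N := by
      rw [← ofAdd_nsmul, ← ofAdd_add]
      apply Multiplicative.toAdd.injective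
      ext i
      simp only [toAdd_ofAdd, Pi.add_apply, nsmul_eq_mul]
      rw [Int.toNat_of_nonneg (Int.emod_nonneg _ hN')]
      exact (Int.emod_add_mul_ediv _ _).symm
    refine QuotientGroup.eq.mpr ?_
    have hv' := congrArg (reduceHom a b) hv
    rw [map_mul, map_pow] at hv'
    rw [hv', inv_mul_cancel_left]
    exact h _
  have := Nat.card_le_card_of_surjective c hc
  rw [Subgroup.index_eq_card]
  simpa using this

/-- A subgroup `(ℤ/a)^b` of `G` is covered, up to index bounded in terms of `π` and `b`, by a
subgroup `(ℤ/a')^b` of `Γ` with `a'` comparable to `a`. Commuting lifts of powers of the generators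
need not have equal orders or be independent, which is why they are restricted to a sublattice. -/
theorem exists_cyclicPower_lift {Γ G : Type*} [Group Γ] [Group G] (π : Γ →* G)
    [Finite π.ker] [π.range.FiniteIndex] (b : ℕ) :
    ∃ C : ℕ, ∀ a : ℕ, 0 < a → ∀ θ : CyclicPower a b →* G, Function.Injective θ →
      ∃ a' : ℕ, 0 < a' ∧ a ≤ C * a' ∧
        ∃ (Ψ : CyclicPower a' b →* Γ) (φ : CyclicPower a' b →* CyclicPower a b),
          Function.Injective Ψ ∧ φ.range.index ≤ C ∧ ∀ g, π (Ψ g) = θ (φ g) := by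
  obtain ⟨M, hM, hlift⟩ := exists_pow_commuting_lift (ι := Fin b) π
  set K := Nat.card π.ker
  have hK : 0 < K := Nat.card_pos
  refine ⟨M + (K * M) ^ b, fun a ha θ hθ => ?_⟩
  obtain ⟨x, hxc, hx⟩ := hlift
    (fun i => θ (reduceHom a b (Multiplicative.ofAdd (Pi.single i 1)))) fun i j =>
      ((Commute.all _ _).map (reduceHom a b)).map θ
  obtain ⟨Ψ, hΨ⟩ := exists_hom_of_commute x hxc
  have hkerpow : ∀ k ∈ π.ker, k ^ K = 1 := fun k hk =>
    congrArg Subtype.val (pow_card_eq_one' (x := (⟨k, hk⟩ : π.ker)))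
  have hπΨ : ∀ v, π (Ψ v) = θ (reduceHom a b (v ^ M)) := by
    have : π.comp Ψ = (θ.comp (reduceHom a b)).comp (powMonoidHom M) := by
      refine hom_ext_single fun i c => ?_
      have hc : (Pi.single i c : Fin b → ℤ) = c • Pi.single i 1 := by
        rw [← Pi.single_smul]; simp
      simp only [MonoidHom.comp_apply, powMonoidHom_apply]
      rw [hΨ, map_zpow, hx, hc, ofAdd_zsmul, map_pow, map_pow, map_zpow, map_zpow]
      rw [← zpow_natCast, ← zpow_natCast, zpow_comm]
    exact DFunLike.congr_fun this
  -- `a' = a / gcd(a, M)` is the order of `M` in `ℤ/a`.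
  obtain ⟨a', ha'⟩ : a.gcd M ∣ a := Nat.gcd_dvd_left a M
  obtain ⟨m, hm⟩ : a.gcd M ∣ M := Nat.gcd_dvd_right a M
  have hd : 0 < a.gcd M := Nat.gcd_pos_of_pos_left _ ha
  have ha'pos : 0 < a' := Nat.pos_of_ne_zero fun h => by simp [h] at ha'; omega
  have hcop : a'.Coprime m := by
    have h : a.gcd M * a'.gcd m = a.gcd M * 1 := by
      rw [← Nat.gcd_mul_left, ← ha', ← hm, mul_one]
    exact Nat.eq_of_mul_eq_mul_left hd h
  have hdvd : a ∣ a' * M := ⟨m, by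
    calc a' * M = a' * (a.gcd M * m) := by rw [← hm]
      _ = (a.gcd M * a') * m := by ring
      _ = a * m := by rw [← ha']⟩
  have hkill : ∀ v : Multiplicative (Fin b → ℤ), Ψ (v ^ a') ∈ π.ker := fun v => by
    obtain ⟨t, ht⟩ := hdvd
    rw [MonoidHom.mem_ker, hπΨ, ← pow_mul, ht, mul_comm a, pow_mul,
      (reduceHom_eq_one_iff a b _).mpr ⟨_, rfl⟩, map_one]
  have hdiv : ∀ v : Multiplicative (Fin b → ℤ), π (Ψ v) = 1 → ∃ w, v = w ^ a' := by
    intro v hv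
    rw [hπΨ, map_eq_one_iff θ hθ] at hv
    obtain ⟨w, hw⟩ := (reduceHom_eq_one_iff a b _).mp hv
    rw [← reduceHom_eq_one_iff]
    apply Multiplicative.toAdd.injective
    ext i
    refine (ZMod.intCast_zmod_eq_zero_iff_dvd _ _).mpr ?_
    have h1 : (M : ℤ) * v.toAdd i = a * w.toAdd i := by
      simpa using congrFun (congrArg Multiplicative.toAdd hw) i
    have h2 : (m : ℤ) * v.toAdd i = a' * w.toAdd i := by
      have hd' : ((a.gcd M : ℕ) : ℤ) ≠ 0 := by exact_mod_cast hd.ne'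
      apply mul_left_cancel₀ hd'
      rw [← mul_assoc, ← mul_assoc, ← Nat.cast_mul, ← Nat.cast_mul, ← hm, ← ha', h1]
    exact (Nat.isCoprime_iff_coprime.mpr hcop).dvd_of_dvd_mul_left ⟨_, h2⟩
  -- The kernel of `Ψ` is `a' • L`. Since `L` is free of rank `b`, the restriction of `Ψ` to `L`
  -- has image `L / a' • L`, which is `(ℤ/a')^b`.
  let L : Submodule ℤ (Fin b → ℤ) := AddSubgroup.toIntSubmodule
    (Subgroup.toAddSubgroup' ((Ψ.comp (powMonoidHom a')).ker))
  have hmem : ∀ v : Fin b → ℤ, v ∈ L ↔ Ψ (Multiplicative.ofAdd v ^ a') = 1 := fun v => Iff.rfl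
  obtain ⟨Λ, hΛ, hrange⟩ := exists_injective_range_eq hK L fun v => by
    rw [hmem, Nat.cast_smul_eq_nsmul, ofAdd_nsmul, ← pow_mul, mul_comm, pow_mul, map_pow]
    exact hkerpow _ (hkill _)
  let Λ' : Multiplicative (Fin b → ℤ) →* Multiplicative (Fin b → ℤ) :=
    AddMonoidHom.toMultiplicative Λ.toAddMonoidHom
  have hΛ' : Function.Injective Λ' := hΛ
  have hΛ'mem : ∀ v, Ψ (Λ' v ^ a') = 1 := fun v =>
    (hmem _).mp (hrange ▸ LinearMap.mem_range_self Λ v.toAdd)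
  have hΛ'ex : ∀ u, Ψ (u ^ a') = 1 → ∃ v, Λ' v = u := fun u hu => by
    have : u.toAdd ∈ LinearMap.range Λ := hrange ▸ (hmem _).mpr hu
    exact this
  obtain ⟨Ψ', hΨ'⟩ := exists_factor_reduceHom (a := a') (Ψ.comp Λ') fun v => by
    rw [MonoidHom.comp_apply, map_pow, hΛ'mem]
  obtain ⟨φ, hφ⟩ := exists_factor_reduceHom (a := a')
    ((reduceHom a b).comp ((powMonoidHom M).comp Λ')) fun v => by
      apply hθ
      simp only [MonoidHom.comp_apply, powMonoidHom_apply]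
      rw [← hπΨ, map_pow, hΛ'mem, map_one, map_one]
  refine ⟨a', ha'pos, ?_, Ψ', φ, ?_, ?_, ?_⟩
  · calc a = a.gcd M * a' := ha'
      _ ≤ (M + (K * M) ^ b) * a' :=
        Nat.mul_le_mul_right _ ((Nat.gcd_le_right _ hM).trans (Nat.le_add_right _ _))
  · refine (injective_iff_map_eq_one Ψ').mpr fun g hg => ?_
    obtain ⟨w, rfl⟩ := reduceHom_surjective a' b g
    rw [hΨ', MonoidHom.comp_apply] at hg
    obtain ⟨u, hu⟩ := hdiv _ (by rw [hg, map_one])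
    obtain ⟨v, rfl⟩ := hΛ'ex u (by rw [← hu, hg])
    rw [← map_pow] at hu
    exact (reduceHom_eq_one_iff _ _ _).mpr ⟨v, hΛ' hu⟩
  · refine (index_le_of_pow_mem (N := K * M) (Nat.mul_pos hK hM) _ fun g => ?_).trans
      (Nat.le_add_left _ _)
    obtain ⟨v, rfl⟩ := reduceHom_surjective a b g
    obtain ⟨w, hw⟩ := hΛ'ex (v ^ K) (by
      rw [← pow_mul, mul_comm, pow_mul, map_pow]
      exact hkerpow _ (hkill _))
    refine ⟨reduceHom a' b w, ?_⟩
    rw [hφ]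
    simp only [MonoidHom.comp_apply, powMonoidHom_apply]
    rw [hw, ← pow_mul, map_pow]
  · intro g
    obtain ⟨v, rfl⟩ := reduceHom_surjective a' b g
    rw [hΨ', hφ, MonoidHom.comp_apply, hπΨ]
    rfl

/-! ### Local frames of a covering pulled back along a self-map of the base -/

/-- A frame over `U` of the pullback of `ρ` along `f`: sections `S k`, continuous on `U`, indexed by
a fixed type `F`, such that for `x ∈ U` the points `S k x` enumerate the fibre `ρ ⁻¹' {f x}`
without repetition. The pullback itself is not formed; the sections take values in `X'`, and
their values outside `U` are irrelevant. -/
structure IsFrameOn {F X X' : Type*} [TopologicalSpace X] [TopologicalSpace X'] (ρ : X' → X)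
    (f : X → X) (U : Set X) (S : F → X → X') : Prop where
  continuousOn : ∀ k, ContinuousOn (S k) U
  proj : ∀ k, ∀ x ∈ U, ρ (S k x) = f x
  existsUnique : ∀ x ∈ U, ∀ y, ρ y = f x → ∃! k, S k x = y

section

open Set Topology

variable {F X X' : Type*} [TopologicalSpace X] [TopologicalSpace X'] {ρ : X' → X}

/-- Over a simply connected set every pullback of a covering is trivial. -/
theorem IsCoveringMap.exists_isFrameOn (hρ : IsCoveringMap ρ) {f : X → X} (hf : Continuous f)
    {U : Set X} [SimplyConnectedSpace U] [LocallyPathConnectedSpace U]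
    (hF : ∀ x, Nonempty (F ≃ ρ ⁻¹' {x})) : ∃ S : F → X → X', IsFrameOn ρ f U S := by
  classical
  obtain ⟨u⟩ : Nonempty U := inferInstance
  obtain ⟨e⟩ := hF (f u)
  let q : C(U, X) := ⟨fun x => f x, hf.comp continuous_subtype_val⟩
  have hlift : ∀ k, ∃ s : C(U, X'), s u = e k ∧ ρ ∘ s = q := fun k =>
    (hρ.existsUnique_continuousMap_lifts q u (e k) (e k).2).exists
  choose s hsu hs using hlift
  have hval : ∀ k x, (h : x ∈ U) → (if h : x ∈ U then s k ⟨x, h⟩ else e k) = s k ⟨x, h⟩ :=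
    fun k x h => dif_pos h
  refine ⟨fun k x => if h : x ∈ U then s k ⟨x, h⟩ else e k, fun k => ?_, fun k x hx => ?_,
    fun x hx y hy => ?_⟩
  · rw [continuousOn_iff_continuous_domRestrict]
    refine (s k).continuous.congr fun x => ?_
    exact (hval k x x.2).symm
  · rw [hval k x hx]
    exact congrFun (hs k) ⟨x, hx⟩
  · simp only [hval _ x hx]
    obtain ⟨t, ⟨htx, ht⟩, -⟩ := hρ.existsUnique_continuousMap_lifts q ⟨x, hx⟩ y hy
    have htu : ρ (t u) = f u := congrFun ht u
    refine ⟨e.symm ⟨t u, htu⟩, ?_, fun k hk => ?_⟩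
    · have : ⇑(s (e.symm ⟨t u, htu⟩)) = t :=
        hρ.eq_of_comp_eq (s _).continuous t.continuous ((hs _).trans ht.symm) u (by simp [hsu])
      simp only [this, htx]
    · have : ⇑(s k) = t :=
        hρ.eq_of_comp_eq (s _).continuous t.continuous ((hs _).trans ht.symm) ⟨x, hx⟩
          (hk.trans htx.symm)
      rw [Equiv.eq_symm_apply]
      apply Subtype.ext
      rw [← hsu, this]

theorem IsFrameOn.mono {f : X → X} {U V : Set X} {S : F → X → X'} (h : IsFrameOn ρ f U S)
    (hV : V ⊆ U) : IsFrameOn ρ f V S :=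
  ⟨fun k => (h.continuousOn k).mono hV, fun k x hx => h.proj k x (hV hx),
    fun x hx => h.existsUnique x (hV hx)⟩

/-- Two sections from frames of the same pullback that agree at one point of a preconnected set
agree on the whole set. -/
theorem IsFrameOn.eqOn (hρ : IsCoveringMap ρ) {f : X → X} {W : Set X} (hW : IsPreconnected W)
    {S T : F → X → X'} (hS : IsFrameOn ρ f W S) (hT : IsFrameOn ρ f W T) {k l : F} {t : X}
    (ht : t ∈ W) (h : S k t = T l t) : EqOn (S k) (T l) W :=
  hρ.eqOn_of_comp_eqOn hW (hS.continuousOn k) (hT.continuousOn l)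
    (fun x hx => (hS.proj k x hx).trans (hT.proj l x hx).symm) ht h

/-- Frames of two pullbacks over the same open cover, with the transition data of the first
contained in those of the second, define a map of total spaces matching the frames. -/
theorem exists_continuous_map_frame {ι : Type*} (hρ : IsCoveringMap ρ) (f f' : X ≃ₜ X)
    {V : ι → Set X} (hVo : ∀ i, IsOpen (V i)) (hV : ∀ x, ∃ i, x ∈ V i) {S S' : ι → F → X → X'}
    (hS : ∀ i, IsFrameOn ρ f (V i) (S i)) (hS' : ∀ i, IsFrameOn ρ f' (V i) (S' i))
    (hc : ∀ i j k l, ∀ x ∈ V i ∩ V j, S i k x = S j l x → S' i k x = S' j l x) :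
    ∃ h : X' → X', Continuous h ∧ ∀ i k, ∀ x ∈ V i, h (S i k x) = S' i k x := by
  choose i hi using fun y => hV (f.symm (ρ y))
  have hk : ∀ y, ∃ k, S (i y) k (f.symm (ρ y)) = y := fun y =>
    ((hS (i y)).existsUnique _ (hi y) y (by simp)).exists
  choose k hk using hk
  have hspec : ∀ j l, ∀ x ∈ V j, S' (i (S j l x)) (k (S j l x)) (f.symm (ρ (S j l x))) =
      S' j l x := by
    intro j l x hx
    have hx' : f.symm (ρ (S j l x)) = x := by rw [(hS j).proj l x hx]; simp
    have h1 := hk (S j l x)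
    have h2 := hi (S j l x)
    rw [hx'] at h1 h2 ⊢
    exact hc _ _ _ _ x ⟨h2, hx⟩ h1
  refine ⟨fun y => S' (i y) (k y) (f.symm (ρ y)), continuous_iff_continuousAt.mpr fun y₀ => ?_,
    fun j l x hx => hspec j l x hx⟩
  have hcont : Continuous fun y => f.symm (ρ y) := f.symm.continuous.comp hρ.continuous
  have hnhds : (fun y => f.symm (ρ y)) ⁻¹' V (i y₀) ∈ 𝓝 y₀ :=
    ((hVo _).preimage hcont).mem_nhds (hi y₀)
  have hat : ∀ {T : F → X → X'} {g : X → X}, IsFrameOn ρ g (V (i y₀)) T →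
      ContinuousAt (fun y => T (k y₀) (f.symm (ρ y))) y₀ := fun hT =>
    ContinuousAt.comp (f := fun y => f.symm (ρ y))
      ((hT.continuousOn (k y₀)).continuousAt ((hVo _).mem_nhds (hi y₀))) hcont.continuousAt
  -- Near `y₀` the section through `y₀` passes through every point, as `ρ` is injective near `y₀`.
  obtain ⟨N, hNo, hyN, hNinj⟩ := hρ.isLocalHomeomorph.isLocallyInjective y₀
  have hN : N ∈ 𝓝 y₀ := hNo.mem_nhds hyN
  have hsec : ∀ᶠ y in 𝓝 y₀, S (i y₀) (k y₀) (f.symm (ρ y)) = y := by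
    have h1 : (fun y => S (i y₀) (k y₀) (f.symm (ρ y))) ⁻¹' N ∈ 𝓝 y₀ :=
      (hat (hS (i y₀))) (by simpa only [hk y₀] using hN)
    filter_upwards [hN, h1, hnhds] with y hy1 hy2 hy3
    refine hNinj hy2 hy1 ?_
    rw [(hS (i y₀)).proj _ _ hy3]
    simp
  refine (hat (hS' (i y₀))).congr ?_
  filter_upwards [hsec, hnhds] with y hy1 hy2
  have h2 := hspec (i y₀) (k y₀) _ hy2
  rw [hy1] at h2
  exact h2.symm

/-- If frames of the pullbacks along `f` and `f'` have the same transition data, then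
`f' ∘ f⁻¹` lifts to the total space. -/
theorem exists_homeomorph_frame {ι : Type*} (hρ : IsCoveringMap ρ) (f f' : X ≃ₜ X)
    {V : ι → Set X} (hVo : ∀ i, IsOpen (V i)) (hV : ∀ x, ∃ i, x ∈ V i) {S S' : ι → F → X → X'}
    (hS : ∀ i, IsFrameOn ρ f (V i) (S i)) (hS' : ∀ i, IsFrameOn ρ f' (V i) (S' i))
    (hc : ∀ i j k l, ∀ x ∈ V i ∩ V j, S i k x = S j l x ↔ S' i k x = S' j l x) :
    ∃ h : X' ≃ₜ X', ∀ y, ρ (h y) = (f' * f⁻¹) (ρ y) := by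
  obtain ⟨h, hh, hhS⟩ := exists_continuous_map_frame hρ f f' hVo hV hS hS'
    fun i j k l x hx => (hc i j k l x hx).mp
  obtain ⟨h', hh', hhS'⟩ := exists_continuous_map_frame hρ f' f hVo hV hS' hS
    fun i j k l x hx => (hc i j k l x hx).mpr
  have hpt : ∀ {g : X ≃ₜ X} {T : ι → F → X → X'}, (∀ i, IsFrameOn ρ g (V i) (T i)) →
      ∀ y, ∃ i k, ∃ x ∈ V i, T i k x = y := fun {g T} hT y => by
    obtain ⟨i, hi⟩ := hV (g.symm (ρ y))
    obtain ⟨k, hk, -⟩ := (hT i).existsUnique _ hi y (by simp)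
    exact ⟨i, k, _, hi, hk⟩
  refine ⟨⟨⟨h, h', fun y => ?_, fun y => ?_⟩, hh, hh'⟩, fun y => ?_⟩
  · obtain ⟨i, k, x, hx, rfl⟩ := hpt hS y
    rw [hhS i k x hx, hhS' i k x hx]
  · obtain ⟨i, k, x, hx, rfl⟩ := hpt hS' y
    rw [hhS' i k x hx, hhS i k x hx]
  · obtain ⟨i, k, x, hx, rfl⟩ := hpt hS y
    change ρ (h _) = f' (f.symm _)
    rw [hhS i k x hx, (hS' i).proj k x hx, (hS i).proj k x hx, f.symm_apply_apply]

end

/-! ### Finiteness properties of the group of lifted homeomorphisms -/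

section

open Set Topology

variable {X X' : Type*} [TopologicalSpace X] [TopologicalSpace X']

/-- The group of pairs `(h, f)` of homeomorphisms of `X'` and `X` such that `h` lifts `f`. -/
def liftedHomeo (ρ : X' → X) : Subgroup ((X' ≃ₜ X') × (X ≃ₜ X)) where
  carrier := {p | ∀ y, ρ (p.1 y) = p.2 (ρ y)}
  one_mem' _ := rfl
  mul_mem' {p q} hp hq y := (hp (q.1 y)).trans (congrArg p.2 (hq y))
  inv_mem' {p} hp y := by
    change ρ (p.1.symm y) = p.2.symm (ρ y)
    rw [Homeomorph.eq_symm_apply, ← hp, Homeomorph.apply_symm_apply]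

theorem mem_liftedHomeo {ρ : X' → X} {p : (X' ≃ₜ X') × (X ≃ₜ X)} :
    p ∈ liftedHomeo ρ ↔ ∀ y, ρ (p.1 y) = p.2 (ρ y) := Iff.rfl

/-- The homeomorphism of the base underlying a lifted homeomorphism. -/
def liftedHomeoBase (ρ : X' → X) : liftedHomeo ρ →* (X ≃ₜ X) :=
  (MonoidHom.snd _ _).comp (liftedHomeo ρ).subtype

/-- The homeomorphism of the total space underlying a lifted homeomorphism. -/
def liftedHomeoTotal (ρ : X' → X) : liftedHomeo ρ →* (X' ≃ₜ X') :=
  (MonoidHom.fst _ _).comp (liftedHomeo ρ).subtype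

theorem liftedHomeo_proj {ρ : X' → X} (p : liftedHomeo ρ) (y : X') :
    ρ (liftedHomeoTotal ρ p y) = liftedHomeoBase ρ p (ρ y) := p.2 y

theorem liftedHomeoTotal_injective {ρ : X' → X} (hρ : Function.Surjective ρ) :
    Function.Injective (liftedHomeoTotal ρ) := by
  intro p q h
  refine Subtype.ext (Prod.ext h (Homeomorph.ext fun x => ?_))
  obtain ⟨y, rfl⟩ := hρ x
  have h1 := liftedHomeo_proj p y
  rw [h, liftedHomeo_proj (ρ := ρ)] at h1
  exact h1.symm

theorem IsCoveringMap.nonempty_fiber_equiv {ρ : X' → X} (hρ : IsCoveringMap ρ)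
    [PathConnectedSpace X] (x y : X) : Nonempty (ρ ⁻¹' {x} ≃ ρ ⁻¹' {y}) :=
  ⟨Equiv.ofBijective _
    (hρ.monodromy_bijective (.mk (PathConnectedSpace.somePath x y)))⟩

/-- The group of deck transformations of a finite covering of a path connected space is finite:
a deck transformation is determined by its action on one fibre. -/
theorem IsFiniteCovering.finite_ker_liftedHomeoBase {ρ : X' → X} (hρ : IsFiniteCovering ρ)
    [PathConnectedSpace X] : Finite (liftedHomeoBase ρ).ker := by
  obtain ⟨x⟩ : Nonempty X := inferInstance
  have : Finite (ρ ⁻¹' {x}) := hρ.finite_fiber x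
  have hdeck : ∀ p ∈ (liftedHomeoBase ρ).ker, ∀ y, ρ (liftedHomeoTotal ρ p y) = ρ y := by
    intro p hp y
    rw [liftedHomeo_proj (ρ := ρ), MonoidHom.mem_ker.mp hp]
    rfl
  let r : (liftedHomeoBase ρ).ker → ρ ⁻¹' {x} → ρ ⁻¹' {x} := fun p y =>
    ⟨liftedHomeoTotal ρ p y, (hdeck p p.2 y).trans y.2⟩
  refine Finite.of_injective r fun p q hpq => Subtype.ext ?_
  refine liftedHomeoTotal_injective hρ.surjective (Homeomorph.ext fun y => ?_)
  let γ := PathConnectedSpace.somePath (ρ y) x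
  obtain ⟨Γ, hΓ, hΓ0⟩ := hρ.isCoveringMap.exists_path_lifts γ y γ.source
  have hΓ1 : ρ (Γ 1) = x := (congrFun hΓ 1).trans γ.target
  have h := hρ.isCoveringMap.eq_of_comp_eq
    ((liftedHomeoTotal ρ p).continuous.comp Γ.continuous)
    ((liftedHomeoTotal ρ q).continuous.comp Γ.continuous)
    (funext fun t => (hdeck p p.2 _).trans (hdeck q q.2 _).symm) 1
    (congrArg Subtype.val (congrFun hpq ⟨Γ 1, hΓ1⟩))
  simpa [hΓ0] using congrFun h 0

/-- In a locally connected space, every point of a compact subset of an open set `U` is joined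
inside `U` by a preconnected set to one of finitely many points. -/
theorem IsCompact.exists_finset_preconnected [LocallyConnectedSpace X] {U K : Set X}
    (hK : IsCompact K) (hU : IsOpen U) (hKU : K ⊆ U) :
    ∃ T : Finset X, ∀ x ∈ K, ∃ t ∈ T, ∃ W ⊆ U, IsPreconnected W ∧ t ∈ W ∧ x ∈ W := by
  obtain ⟨T, hTK, hT⟩ := hK.elim_nhds_subcover (fun x => connectedComponentIn U x)
    fun x hx => hU.connectedComponentIn.mem_nhds (mem_connectedComponentIn (hKU hx))
  refine ⟨T, fun x hx => ?_⟩
  obtain ⟨t, ht, hxt⟩ := mem_iUnion₂.mp (hT hx)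
  exact ⟨t, ht, _, connectedComponentIn_subset U t, isPreconnected_connectedComponentIn,
    mem_connectedComponentIn (hKU (hTK t ht)), hxt⟩

/-- Every point of a manifold has a simply connected open neighbourhood. -/
theorem exists_isOpen_simplyConnected (n : ℕ) [ChartedSpace (EuclideanSpace ℝ (Fin n)) X] (x : X) :
    ∃ U : Set X, IsOpen U ∧ x ∈ U ∧ SimplyConnectedSpace U := by
  let c := chartAt (EuclideanSpace ℝ (Fin n)) x
  obtain ⟨ε, hε, hball⟩ := Metric.isOpen_iff.mp c.open_target (c x) (mem_chart_target _ x)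
  let e := (OpenPartialHomeomorph.univBall (c x) ε).trans c.symm
  have he : e.source = univ := by
    refine eq_univ_of_forall fun v => ?_
    rw [OpenPartialHomeomorph.trans_source]
    refine ⟨by simp, hball ?_⟩
    rw [← OpenPartialHomeomorph.univBall_target (c x) hε]
    exact OpenPartialHomeomorph.map_source _ (by simp)
  have hemb := e.isOpenEmbedding he
  refine ⟨range e, hemb.isOpen_range, ⟨0, ?_⟩, ?_⟩
  · simp only [e, OpenPartialHomeomorph.coe_trans, Function.comp_apply,
      OpenPartialHomeomorph.univBall_apply_zero]
    exact c.left_inv (mem_chart_source _ x)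
  · have : ContractibleSpace (range e) := hemb.isEmbedding.toHomeomorph.symm.contractibleSpace
    infer_instance

/-- Only finitely many cosets of homeomorphisms of `X` are distinguished by lifting to a finite
covering `X'`. The coset of `f` is determined by which sections of local frames of the pullback
along `f⁻¹` agree at finitely many points of `X`, and this is an element of a finite set. -/
theorem IsFiniteCovering.finiteIndex_range_liftedHomeoBase {ρ : X' → X} (hρ : IsFiniteCovering ρ)
    [CompactSpace X] [T2Space X] [PathConnectedSpace X] [LocallyPathConnectedSpace X]
    (hsc : ∀ x : X, ∃ U : Set X, IsOpen U ∧ x ∈ U ∧ SimplyConnectedSpace U) :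
    (liftedHomeoBase ρ).range.FiniteIndex := by
  obtain ⟨x₀⟩ : Nonempty X := inferInstance
  have : Finite (ρ ⁻¹' {x₀}) := hρ.finite_fiber x₀
  choose U hUo hxU hUsc using hsc
  choose C hCn hCc hCU using fun x => exists_mem_nhds_isClosed_subset ((hUo x).mem_nhds (hxU x))
  obtain ⟨A, hA⟩ := CompactSpace.elim_nhds_subcover (fun x => interior (C x))
    fun x => interior_mem_nhds.mpr (hCn x)
  have hcover : ∀ x, ∃ i : A, x ∈ interior (C i) := fun x => by
    obtain ⟨i, hi, hx⟩ := mem_iUnion₂.mp (show x ∈ ⋃ i ∈ A, interior (C i) from hA ▸ mem_univ x)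
    exact ⟨⟨i, hi⟩, hx⟩
  -- Sections over `U i` and `U j` are compared only over `C i ∩ C j`: it is compact, whereas
  -- `U i ∩ U j` may have infinitely many components.
  choose N hN using fun i j : A => ((hCc i).inter (hCc j)).isCompact.exists_finset_preconnected
    ((hUo i).inter (hUo j)) (inter_subset_inter (hCU i) (hCU j))
  have hframe : ∀ (f : X ≃ₜ X) (i : A), ∃ S : ρ ⁻¹' {x₀} → X → X', IsFrameOn ρ f (U i) S :=
    fun f i => by
      have := (hUo i).locallyPathConnectedSpace
      exact hρ.isCoveringMap.exists_isFrameOn f.continuous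
        fun x => hρ.isCoveringMap.nonempty_fiber_equiv x₀ x
  choose S hS using hframe
  let c : (X ≃ₜ X) → ∀ i j : A, N i j → ρ ⁻¹' {x₀} → ρ ⁻¹' {x₀} → Prop :=
    fun f i j t k l => S f i k t = S f j l t
  have hlift : ∀ f f' : X ≃ₜ X, c f = c f' → f' * f⁻¹ ∈ (liftedHomeoBase ρ).range := by
    intro f f' hff'
    obtain ⟨h, hh⟩ := exists_homeomorph_frame hρ.isCoveringMap f f'
      (V := fun i : A => interior (C i)) (fun i => isOpen_interior) hcover
      (fun i => (hS f i).mono (interior_subset.trans (hCU i)))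
      (fun i => (hS f' i).mono (interior_subset.trans (hCU i))) fun i j k l x hx => by
        obtain ⟨t, ht, W, hWU, hW, htW, hxW⟩ :=
          hN i j x (inter_subset_inter interior_subset interior_subset hx)
        have hmove : ∀ g, S g i k x = S g j l x ↔ S g i k t = S g j l t := fun g => by
          have h1 := (hS g i).mono (hWU.trans inter_subset_left)
          have h2 := (hS g j).mono (hWU.trans inter_subset_right)
          exact ⟨fun h => h1.eqOn hρ.isCoveringMap hW h2 hxW h htW,
            fun h => h1.eqOn hρ.isCoveringMap hW h2 htW h hxW⟩
        rw [hmove f, hmove f']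
        have h3 : c f i j ⟨t, ht⟩ k l = c f' i j ⟨t, ht⟩ k l := by rw [hff']
        exact h3.to_iff
    exact ⟨⟨(h, f' * f⁻¹), hh⟩, rfl⟩
  have : Finite ((X ≃ₜ X) ⧸ (liftedHomeoBase ρ).range) := by
    refine Finite.of_injective (fun q => c q.out⁻¹) fun q q' hqq' => ?_
    -- `G ⧸ H` consists of left cosets, so `c` is applied to inverses of representatives.
    rw [← q.out_eq', ← q'.out_eq', eq_comm]
    exact QuotientGroup.eq.mpr (by simpa using hlift _ _ hqq')
  exact Subgroup.finiteIndex_of_finite_quotient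

end

/-! ### Effective actions on the covering space -/

theorem theorem1p9 {X : Type*} {X' : Type*} [TopologicalSpace X] [TopologicalSpace X']
    (n : ℕ) [ChartedSpace (EuclideanSpace ℝ (Fin n)) X] [T2Space X] [CompactSpace X]
    [ConnectedSpace X] (ρ : X' → X) (hρ : IsFiniteCovering ρ) :
    discSym X ≤ discSym X' ∧
    ∀ b : ℕ, ∃ C : ℕ, ∀ a : ℕ, 0 < a →
      ∀ θ : CyclicPower a b →* (X ≃ₜ X), Function.Injective θ →
        ∃ a' : ℕ, 0 < a' ∧ a ≤ C * a' ∧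
          ∃ (θ' : CyclicPower a' b →* (X' ≃ₜ X')) (φ : CyclicPower a' b →* CyclicPower a b),
            Function.Injective θ' ∧ φ.range.index ≤ C ∧
            ∀ (g : CyclicPower a' b) (x' : X'), ρ (θ' g x') = θ (φ g) (ρ x') := by
  have : LocallyPathConnectedSpace X :=
    ChartedSpace.locallyPathConnectedSpace (EuclideanSpace ℝ (Fin n)) X
  have : PathConnectedSpace X := PathConnectedSpace.of_locallyPathConnectedSpace
  have := hρ.finite_ker_liftedHomeoBase
  have := hρ.finiteIndex_range_liftedHomeoBase (exists_isOpen_simplyConnected n)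
  have key : ∀ b : ℕ, ∃ C : ℕ, ∀ a : ℕ, 0 < a →
      ∀ θ : CyclicPower a b →* (X ≃ₜ X), Function.Injective θ →
        ∃ a' : ℕ, 0 < a' ∧ a ≤ C * a' ∧
          ∃ (θ' : CyclicPower a' b →* (X' ≃ₜ X')) (φ : CyclicPower a' b →* CyclicPower a b),
            Function.Injective θ' ∧ φ.range.index ≤ C ∧
            ∀ (g : CyclicPower a' b) (x' : X'), ρ (θ' g x') = θ (φ g) (ρ x') := by
    intro b
    obtain ⟨C, hC⟩ := exists_cyclicPower_lift (liftedHomeoBase ρ) b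
    refine ⟨C, fun a ha θ hθ => ?_⟩
    obtain ⟨a', ha', hle, Ψ, φ, hΨ, hφ, hcomm⟩ := hC a ha θ hθ
    refine ⟨a', ha', hle, (liftedHomeoTotal ρ).comp Ψ, φ,
      (liftedHomeoTotal_injective hρ.surjective).comp hΨ, hφ, fun g y => ?_⟩
    rw [← hcomm]
    exact liftedHomeo_proj (Ψ g) y
  refine ⟨iSup₂_le fun m hm => ?_, key⟩
  refine le_iSup₂ (f := fun (m : ℕ) (_ : m ∈ ({0} ∪ muSet X' : Set ℕ)) => (m : ℕ∞)) m ?_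
  rcases hm with hm | ⟨hm1, hm⟩
  · exact Or.inl hm
  · obtain ⟨C, hC⟩ := key m
    refine Or.inr ⟨hm1, fun N => ?_⟩
    obtain ⟨r, hr, θ, hθ⟩ := hm (C * N)
    obtain ⟨a', -, hle, θ', -, hθ', -⟩ := hC r (Nat.zero_lt_of_lt hr) θ hθ
    exact ⟨a', lt_of_mul_lt_mul_left (hr.trans_le hle) (Nat.zero_le C), θ', hθ'⟩
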